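/- Let $\nu:\mathbb N\to\mathbb R$ be monotone (non-decreasing) with $\nu(n)\to\infty$. Then there exist real numbers $a_j\in(-1,1)$, $j\ge 0$, with $\sum_j a_j^2<\infty$, and, on some probability space, independent random variables $\omega_n$, $n\ge 0$, with values in the open unit disc $\mathbb D=\{|z|<1\}$ that are rotationally symmetric ($u\,\omega_n$ has the same law as $\omega_n$ whenever $u\in\mathbb C$, $|u|=1$), such that the following two properties hold. (i) With $R_n=\sum_{m\ge n}a_m^2$, $$\sum_{n\ge 2}\frac{\sqrt{R_n}}{\nu(n)\,n\sqrt{\log n}}<\infty,$$ where the (finitely many) $n$ with $\nu(n)=0$, if any, are omitted from the sum. (ii) Let $\alpha_n=a_n\omega_n$, and let $\Phi_n$ be the monic orthogonal polynomials on the unit circle with the random Verblunsky coefficients $\alpha_n$, that is, $\Phi_0=\Phi_0^*=1$ and $$\Phi_{n+1}(z)=z\Phi_n(z)-\overline{\alpha_n}\,\Phi_n^*(z),\qquad \Phi_{n+1}^*(z)=\Phi_n^*(z)-\alpha_n z\,\Phi_n(z).$$ Then almost surely there is a (random) $\theta^*\in[0,2\pi)$ with $\sup_n|\Phi_n(e^{i\theta^*})|=\infty$.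 -/

import Mathlib

open MeasureTheory ProbabilityTheory Filter Polynomial
open scoped ENNReal ComplexConjugate

/-- The pair `(Φ_n, Φ_n^*)` of polynomials generated from the Verblunsky coefficients `α` by the
Szegő recursion `Φ_{n+1} = z Φ_n - conj (α_n) Φ_n^*`, `Φ_{n+1}^* = Φ_n^* - α_n z Φ_n`,
started from `Φ_0 = Φ_0^* = 1`. -/
noncomputable def szegoPair (α : ℕ → ℂ) : ℕ → ℂ[X] × ℂ[X]
  | 0 => (1, 1)
  | n + 1 =>
    (X * (szegoPair α n).1 - C (conj (α n)) * (szegoPair α n).2,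
      (szegoPair α n).2 - C (α n) * X * (szegoPair α n).1)

/-- The monic orthogonal polynomial `Φ_n` with Verblunsky coefficients `α`. -/
noncomputable def szegoPoly (α : ℕ → ℂ) (n : ℕ) : ℂ[X] := (szegoPair α n).1

/-- The reversed polynomial `Φ_n^*`. -/
noncomputable def szegoRev (α : ℕ → ℂ) (n : ℕ) : ℂ[X] := (szegoPair α n).2

/-- On the unit circle, `Φ_n^*(z) = z^n conj (Φ_n(z))`. -/
theorem szegoRev_eval (α : ℕ → ℂ) (n : ℕ) (z : ℂ) (hz : ‖z‖ = 1) :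
    (szegoRev α n).eval z = z ^ n * conj ((szegoPoly α n).eval z) := by
  have h1 : z * conj z = 1 := by
    rw [Complex.mul_conj, Complex.normSq_eq_norm_sq, hz]; simp
  induction n with
  | zero => simp [szegoRev, szegoPoly, szegoPair]
  | succ n ih =>
    have hp : (szegoPoly α (n + 1)).eval z
        = z * (szegoPoly α n).eval z - conj (α n) * (szegoRev α n).eval z := by
      simp [szegoPoly, szegoRev, szegoPair]
    have hr : (szegoRev α (n + 1)).eval z
        = (szegoRev α n).eval z - α n * z * (szegoPoly α n).eval z := by
      simp [szegoPoly, szegoRev, szegoPair]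
    have h2 : z ^ n * conj z ^ n = 1 := by rw [← mul_pow, h1, one_pow]
    rw [hp, hr, ih]
    simp only [map_sub, map_mul, map_pow, Complex.conj_conj]
    linear_combination (-(z ^ n * conj ((szegoPoly α n).eval z))) * h1
      + (α n * z * (szegoPoly α n).eval z) * h2

/-- The tail `R_n = ∑_{m ≥ n} a_m ^ 2`. -/
noncomputable def tailSq (a : ℕ → ℝ) (n : ℕ) : ℝ := ∑' m : ℕ, a (n + m) ^ 2

/-- The complex random variable `Y` is rotationally symmetric: `u Y` has the same law as `Y` for
every unimodular constant `u`. -/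
def IsRotationallySymmetric {Ω : Type*} [MeasurableSpace Ω] (P : Measure Ω) (Y : Ω → ℂ) : Prop :=
  ∀ u : ℂ, ‖u‖ = 1 → IdentDistrib (fun x => u * Y x) Y P P

/-! On the circle `|Φ_n| = |Φ_n^*|`, and one step reads `Φ_{n+1}^* = Φ_n^* - α_n z^(n+1) conj
Φ_n^*`. Let the nonzero coefficients sit only at `n + 1 = 128^(i+1)`. Before such a step `Φ_n^*`
varies little, relative to its size, over one period of `z^(n+1)`, so some nearby point sees its
modulus multiplied by almost `1 + |α_n|` (`RelLipschitz.exists_growth`). Following these points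
leads to a limit angle where `|Φ_n^*|` is at least a constant times `exp (∑ |α_j| / 4)`. Only
divergence of `∑ |α_j|` matters, not the phases; with `|ω_n| = 1/2` this is deterministic and every
sample works.

It remains to find moduli `c` outside `ℓ¹` satisfying (i). Condensation along `128^k` reduces (i) to
`∑ (∑_{m ≥ k} c_m²)^(1/2) / (μ_k √(k+1)) < ∞` with `μ_k = max (ν (128^k)) 1`. The block `1_{i<n} /
n` has `ℓ¹` norm 1, yet contributes at most `n^(-1/2) ∑_{i<n} 1 / (μ_i √(i+1))`, which tends to 0
because `μ → ∞`. Adding the squares of blocks of rapidly growing length gives `c`. -/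

theorem exists_mem_Ico_exp_I_mul_eq (w : ℂ) (hw : ‖w‖ = 1) :
    ∃ t ∈ Set.Ico (0 : ℝ) (2 * Real.pi), Complex.exp (Complex.I * t) = w := by
  refine ⟨toIcoMod Real.two_pi_pos 0 w.arg, by simpa using toIcoMod_mem_Ico Real.two_pi_pos 0 w.arg,
    ?_⟩
  rw [← self_sub_toIcoDiv_zsmul]
  have h : Complex.exp (w.arg * Complex.I) = w := by
    simpa [hw] using Complex.norm_mul_exp_arg_mul_I w
  have h2 : Complex.exp
        (Complex.I * ((w.arg - toIcoDiv Real.two_pi_pos 0 w.arg • (2 * Real.pi) : ℝ) : ℂ))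
      = Complex.exp (w.arg * Complex.I
        - (toIcoDiv Real.two_pi_pos 0 w.arg : ℤ) * (2 * Real.pi * Complex.I)) := by
    congr 1
    push_cast [zsmul_eq_mul]
    ring
  rw [h2, Complex.exp_sub, h, Complex.exp_int_mul_two_pi_mul_I, div_one]

/-! ### One Szegő step for slowly varying functions -/

/-- The function `G` has relative Lipschitz constant `B`: its increments are controlled by
its value at the base point. -/
def RelLipschitz (B : ℝ) (G : ℝ → ℂ) : Prop :=
  ∀ θ Δ : ℝ, ‖G (θ + Δ) - G θ‖ ≤ B * |Δ| * ‖G θ‖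

/-- One step of the Szegő recursion on the circle for a coefficient `β` at frequency `N`. -/
noncomputable def szegoStep (N : ℝ) (β : ℂ) (G : ℝ → ℂ) (θ : ℝ) : ℂ :=
  G θ - β * Complex.exp (Complex.I * (N * θ : ℝ)) * conj (G θ)

theorem norm_exp_I_mul (x : ℝ) : ‖Complex.exp (Complex.I * x)‖ = 1 := by
  rw [mul_comm]; exact Complex.norm_exp_ofReal_mul_I x

theorem norm_exp_I_mul_sub_le (x y : ℝ) :
    ‖Complex.exp (Complex.I * (x + y : ℝ)) - Complex.exp (Complex.I * x)‖ ≤ |y| := by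
  have h : Complex.exp (Complex.I * (x + y : ℝ)) - Complex.exp (Complex.I * x)
      = Complex.exp (Complex.I * x) * (Complex.exp (Complex.I * y) - 1) := by
    rw [mul_sub, ← Complex.exp_add]; push_cast; ring_nf
  rw [h, norm_mul, norm_exp_I_mul, one_mul]
  simpa using Real.norm_exp_I_mul_ofReal_sub_one_le (x := y)

theorem RelLipschitz.step {B B' N : ℝ} {β : ℂ} {G : ℝ → ℂ} (hG : RelLipschitz B G)
    (hN : 0 ≤ N) (hB' : 0 ≤ B')
    (h : B * (1 + ‖β‖) + ‖β‖ * N ≤ B' * (1 - ‖β‖)) :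
    RelLipschitz B' (szegoStep N β G) := by
  intro θ Δ
  set f := G θ with hf
  set D := G (θ + Δ) - G θ with hD
  set e := Complex.exp (Complex.I * (N * θ : ℝ))
  set e' := Complex.exp (Complex.I * (N * (θ + Δ) : ℝ))
  have he : ‖e‖ = 1 := norm_exp_I_mul _
  have he' : ‖e'‖ = 1 := norm_exp_I_mul _
  have hee : ‖e' - e‖ ≤ N * |Δ| := by
    have := norm_exp_I_mul_sub_le (N * θ) (N * Δ)
    rwa [← mul_add, abs_mul, abs_of_nonneg hN] at this
  have hDle : ‖D‖ ≤ B * |Δ| * ‖f‖ := hG θ Δ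
  have h1 : szegoStep N β G (θ + Δ) - szegoStep N β G θ
      = D - β * e' * conj D - β * (e' - e) * conj f := by
    simp only [szegoStep, hD, hf, e, e', map_sub]; ring
  have h2 : ‖szegoStep N β G (θ + Δ) - szegoStep N β G θ‖
      ≤ ‖D‖ + ‖β‖ * ‖D‖ + ‖β‖ * (N * |Δ|) * ‖f‖ := by
    rw [h1]
    refine (norm_sub_le _ _).trans (add_le_add ((norm_sub_le _ _).trans ?_) ?_)
    · simp [he']
    · simp only [norm_mul, RCLike.norm_conj]; gcongr
  have h3 : ‖f‖ * (1 - ‖β‖) ≤ ‖szegoStep N β G θ‖ := by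
    have h4 : ‖f‖ - ‖β * e * conj f‖ ≤ ‖f - β * e * conj f‖ := norm_sub_norm_le _ _
    simp only [norm_mul, RCLike.norm_conj, he, mul_one] at h4
    calc _ = ‖f‖ - ‖β‖ * ‖f‖ := by ring
      _ ≤ _ := h4
  calc _ ≤ _ := h2
    _ ≤ (B * |Δ| * ‖f‖) + ‖β‖ * (B * |Δ| * ‖f‖) + ‖β‖ * (N * |Δ|) * ‖f‖ := by gcongr
    _ = (B * (1 + ‖β‖) + ‖β‖ * N) * (|Δ| * ‖f‖) := by ring
    _ ≤ B' * (1 - ‖β‖) * (|Δ| * ‖f‖) := by gcongr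
    _ = B' * |Δ| * (‖f‖ * (1 - ‖β‖)) := by ring
    _ ≤ _ := by gcongr

/-- As `Δ` runs over one period of `exp (I N Δ)`, the correction term with `G` frozen at `θ` takes
every phase, so it can be aligned with `G θ`. Unfreezing `G` costs the factor `1 - B Δ`. -/
theorem RelLipschitz.exists_growth {B N : ℝ} {β : ℂ} {G : ℝ → ℂ} (hG : RelLipschitz B G)
    (hN : 0 < N) (θ : ℝ) :
    ∃ Δ ∈ Set.Ico 0 (2 * Real.pi / N),
      ‖G θ‖ * ((1 + ‖β‖) * (1 - B * Δ)) ≤ ‖szegoStep N β G (θ + Δ)‖ := by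
  set f := G θ with hf
  set e := Complex.exp (Complex.I * (N * θ : ℝ)) with he_def
  have he : ‖e‖ = 1 := norm_exp_I_mul _
  -- `w` is the phase that turns the subtracted term into `-‖β‖ f`.
  obtain ⟨w, hw, hwf⟩ : ∃ w : ℂ, ‖w‖ = 1 ∧ β * e * w * conj f = -(‖β‖ * f) := by
    by_cases h0 : β = 0 ∨ f = 0
    · exact ⟨1, by simp, by rcases h0 with h | h <;> simp [h]⟩
    · push Not at h0
      have hf0 : conj f ≠ 0 := by simpa using h0.2
      have he0 : e ≠ 0 := Complex.exp_ne_zero _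
      refine ⟨-(‖β‖ * f) / (β * e * conj f), ?_, ?_⟩
      · have h1 : ‖β‖ ≠ 0 := by simpa using h0.1
        have h2 : ‖f‖ ≠ 0 := by simpa using h0.2
        simp [he, h1, h2]
      · have := h0.1
        field_simp
  obtain ⟨t, ht, htw⟩ := exists_mem_Ico_exp_I_mul_eq w hw
  refine ⟨t / N, ⟨by have := ht.1; positivity, by have := ht.2; gcongr⟩, ?_⟩
  set g := G (θ + t / N)
  have hg : ‖g - f‖ ≤ B * (t / N) * ‖f‖ := by
    have := hG θ (t / N)
    rwa [abs_of_nonneg (by have := ht.1; positivity)] at this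
  have h1 : szegoStep N β G (θ + t / N)
      = (1 + ‖β‖) * f - (β * e * w * conj (g - f) - (g - f)) := by
    have h2 : Complex.exp (Complex.I * (N * (θ + t / N) : ℝ)) = e * w := by
      rw [he_def, ← htw, ← Complex.exp_add, mul_add, mul_div_cancel₀ _ hN.ne']
      push_cast; ring_nf
    simp only [szegoStep, h2, map_sub]
    linear_combination -hwf
  have h3 : ‖β * e * w * conj (g - f) - (g - f)‖ ≤ (1 + ‖β‖) * ‖g - f‖ := by
    refine (norm_sub_le _ _).trans (le_of_eq ?_)
    rw [norm_mul, norm_mul, norm_mul, he, hw, RCLike.norm_conj]; ring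
  have h4 : ‖(1 + ‖β‖ : ℂ) * f‖ = (1 + ‖β‖) * ‖f‖ := by
    rw [norm_mul]; congr 1
    rw [← Complex.ofReal_one, ← Complex.ofReal_add, Complex.norm_real, Real.norm_eq_abs,
      abs_of_nonneg (by positivity)]
  have h5 := norm_sub_norm_le ((1 + ‖β‖ : ℂ) * f) (β * e * w * conj (g - f) - (g - f))
  rw [← h1, h4] at h5
  have h6 : (1 + ‖β‖) * ‖g - f‖ ≤ (1 + ‖β‖) * (B * (t / N) * ‖f‖) := by gcongr
  linarith

theorem exp_le_one_add_mul_one_sub {s x : ℝ} (hs : 0 ≤ s) (hs' : s ≤ 1 / 2) (hx : 0 ≤ x)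
    (hx' : x ≤ 1 / 2) : Real.exp (s / 2 - 2 * x) ≤ (1 + s) * (1 - x) := by
  have h1 : Real.exp (s / 2) ≤ 1 + s := by
    rw [← Real.le_log_iff_exp_le (by linarith)]
    have := Real.one_sub_inv_le_log_of_pos (x := 1 + s) (by linarith)
    refine le_trans ?_ this
    have h : (1 + s)⁻¹ ≤ 1 - s / 2 := by
      rw [inv_le_iff_one_le_mul₀ (by linarith)]; nlinarith
    linarith
  have h2 : Real.exp (-(2 * x)) ≤ 1 - x := by
    rw [← Real.le_log_iff_exp_le (by linarith)]
    have := Real.one_sub_inv_le_log_of_pos (x := 1 - x) (by linarith)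
    refine le_trans ?_ this
    have h : (1 - x)⁻¹ ≤ 1 + 2 * x := by
      rw [inv_le_iff_one_le_mul₀ (by linarith)]; nlinarith
    linarith
  rw [sub_eq_add_neg, Real.exp_add]
  gcongr

/-! ### Growth along lacunary frequencies -/

/-- Iterated Szegő steps with coefficients `β i` at the lacunary frequencies `128 ^ (i + 1)`. -/
noncomputable def lacunarySzego (β : ℕ → ℂ) : ℕ → ℝ → ℂ
  | 0 => fun _ => 1
  | i + 1 => szegoStep (128 ^ (i + 1)) (β i) (lacunarySzego β i)

/-- Relative Lipschitz constants of `lacunarySzego β i`, in units of the frequency. -/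
noncomputable def lacunaryRate (β : ℕ → ℂ) : ℕ → ℝ
  | 0 => 0
  | i + 1 => (3 * lacunaryRate β i + 2 * ‖β i‖) / 128

theorem lacunaryRate_succ (β : ℕ → ℂ) (i : ℕ) :
    lacunaryRate β (i + 1) = (3 * lacunaryRate β i + 2 * ‖β i‖) / 128 := rfl

theorem lacunaryRate_mem (β : ℕ → ℂ) (hβ : ∀ i, ‖β i‖ ≤ 1 / 2) (i : ℕ) :
    0 ≤ lacunaryRate β i ∧ lacunaryRate β i ≤ 1 / 64 := by
  induction i with
  | zero => norm_num [lacunaryRate]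
  | succ i ih =>
    have := hβ i
    have := norm_nonneg (β i)
    simp only [lacunaryRate]
    constructor <;> linarith

/-- For `‖β‖ ≤ 1/2` one has `(1 + ‖β‖) / (1 - ‖β‖) ≤ 3` and `1 / (1 - ‖β‖) ≤ 2`; these are the 3 and
2 in `lacunaryRate`, and the 128 is the change of frequency unit. -/
theorem lacunarySzego_relLipschitz (β : ℕ → ℂ) (hβ : ∀ i, ‖β i‖ ≤ 1 / 2) (i : ℕ) :
    RelLipschitz (lacunaryRate β i * 128 ^ (i + 1)) (lacunarySzego β i) := by
  induction i with
  | zero => intro θ Δ; simp [lacunarySzego, lacunaryRate]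
  | succ i ih =>
    have h0 := (lacunaryRate_mem β hβ i).1
    have h1 := (lacunaryRate_mem β hβ (i + 1)).1
    refine ih.step (by positivity) (by positivity) ?_
    have h2 := hβ i
    have h3 := norm_nonneg (β i)
    have h4 : (lacunaryRate β i * (1 + ‖β i‖) + ‖β i‖)
        ≤ (3 * lacunaryRate β i + 2 * ‖β i‖) * (1 - ‖β i‖) := by
      nlinarith [mul_nonneg h0 (sub_nonneg.2 h2), mul_nonneg h3 (sub_nonneg.2 h2)]
    calc _ = (lacunaryRate β i * (1 + ‖β i‖) + ‖β i‖) * 128 ^ (i + 1) := by ring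
      _ ≤ (3 * lacunaryRate β i + 2 * ‖β i‖) * (1 - ‖β i‖) * 128 ^ (i + 1) := by gcongr
      _ = _ := by rw [lacunaryRate_succ]; ring

/-- Lacunary Szegő iterates with non-summable coefficients are unbounded at some point. -/
theorem exists_lacunarySzego_unbounded (β : ℕ → ℂ) (hβ : ∀ i, ‖β i‖ ≤ 1 / 2)
    (hsum : ¬ Summable fun i => ‖β i‖) :
    ∃ θ ∈ Set.Ico (0 : ℝ) (2 * Real.pi), Tendsto (fun i => ‖lacunarySzego β i θ‖) atTop atTop := by
  have hpi := Real.pi_pos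
  have hpi' := Real.pi_lt_d2
  choose δ hδ hgrow using fun (i : ℕ) (θ : ℝ) =>
    (lacunarySzego_relLipschitz β hβ i).exists_growth (β := β i) (N := 128 ^ (i + 1))
      (by positivity) θ
  -- Greedy path: each move goes to a growth point within one period of the current frequency.
  let d : ℕ → ℝ := fun i => Nat.rec (motive := fun _ => ℝ) 0 (fun i θ => θ + δ i θ) i
  have hd : ∀ i, d (i + 1) = d i + δ i (d i) := fun i => rfl
  -- The term `16 * lacunaryRate` is a reserve. With `s = ‖β i‖` and rate `b`, a step gains `s/2`
  -- and loses at most `12.6 b`, leaving enough for `s/4` and the next reserve `(3 b + 2 s) / 8`.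
  have hexp : ∀ i, Real.exp ((∑ m ∈ Finset.range i, ‖β m‖) / 4 + 16 * lacunaryRate β i)
      ≤ ‖lacunarySzego β i (d i)‖ := by
    intro i
    induction i with
    | zero => simp [lacunarySzego, lacunaryRate]
    | succ i ih =>
      obtain ⟨h0, h1⟩ := lacunaryRate_mem β hβ i
      set b := lacunaryRate β i with hb
      have hx : b * 128 ^ (i + 1) * δ i (d i) ≤ 2 * Real.pi * b := by
        have := (hδ i (d i)).2.le
        rw [le_div_iff₀ (by positivity)] at this
        calc _ = b * (δ i (d i) * 128 ^ (i + 1)) := by ring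
          _ ≤ b * (2 * Real.pi) := by gcongr
          _ = _ := by ring
      have hx0 : 0 ≤ b * 128 ^ (i + 1) * δ i (d i) := by
        have := (hδ i (d i)).1; positivity
      have hb7 : 2 * Real.pi * b ≤ 6.3 * b := by gcongr; linarith
      have key := exp_le_one_add_mul_one_sub (norm_nonneg (β i)) (hβ i) hx0 (by linarith)
      rw [hd]
      refine le_trans ?_ (hgrow i (d i))
      refine le_trans ?_ (mul_le_mul ih key (by positivity) (by positivity))
      rw [← Real.exp_add, Finset.sum_range_succ]
      refine Real.exp_le_exp.2 ?_
      rw [lacunaryRate_succ, ← hb]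
      have := norm_nonneg (β i)
      linarith
  have hstep : ∀ i, dist (d i) (d (i + 1)) ≤ 2 * Real.pi / 128 * (1 / 128) ^ i := by
    intro i
    rw [hd, Real.dist_eq, sub_add_cancel_left, abs_neg, abs_of_nonneg (hδ i (d i)).1]
    refine (hδ i (d i)).2.le.trans (le_of_eq ?_)
    rw [pow_succ, one_div_pow]; field_simp
  obtain ⟨θ, hθ⟩ := cauchySeq_tendsto_of_complete
    (cauchySeq_of_le_geometric _ _ (by norm_num) hstep)
  have hdist : ∀ i, dist (d i) θ ≤ 2 * Real.pi / 127 * (1 / 128) ^ i := fun i =>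
    (dist_le_of_le_geometric_of_tendsto _ _ (by norm_num) hstep hθ i).trans
      (le_of_eq (by ring))
  have hmono : Monotone d := monotone_nat_of_le_succ fun i => by
    rw [hd]; linarith [(hδ i (d i)).1]
  refine ⟨θ, ⟨hmono.ge_of_tendsto hθ 0, ?_⟩, ?_⟩
  · have h := hdist 0
    rw [Real.dist_eq] at h
    have h2 : d 0 = 0 := rfl
    rw [h2, zero_sub, abs_neg] at h
    have := le_abs_self θ
    simp only [pow_zero] at h
    linarith
  -- The remaining distance from `d i` to the limit is so short that the relative Lipschitz bound
  -- loses at most half the modulus.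
  · have hlow : ∀ i, 1 / 2 * Real.exp ((∑ m ∈ Finset.range i, ‖β m‖) / 4)
        ≤ ‖lacunarySzego β i θ‖ := by
      intro i
      obtain ⟨h0, h1⟩ := lacunaryRate_mem β hβ i
      set b := lacunaryRate β i with hb
      have hL := lacunarySzego_relLipschitz β hβ i (d i) (θ - d i)
      rw [add_sub_cancel] at hL
      have h2 : b * 128 ^ (i + 1) * |θ - d i| ≤ 1 / 2 := by
        have h3 := hdist i
        rw [dist_comm, Real.dist_eq] at h3
        calc _ ≤ b * 128 ^ (i + 1) * (2 * Real.pi / 127 * (1 / 128) ^ i) := by gcongr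
          _ = b * (256 * Real.pi / 127) := by rw [pow_succ, one_div_pow]; field_simp; ring
          _ ≤ 1 / 64 * (256 * Real.pi / 127) := by gcongr
          _ ≤ _ := by linarith
      have h4 := norm_sub_norm_le (lacunarySzego β i (d i)) (lacunarySzego β i θ)
      rw [norm_sub_rev] at h4
      have h5 : b * 128 ^ (i + 1) * |θ - d i| * ‖lacunarySzego β i (d i)‖
          ≤ 1 / 2 * ‖lacunarySzego β i (d i)‖ := by gcongr
      have h6 : Real.exp ((∑ m ∈ Finset.range i, ‖β m‖) / 4)
          ≤ Real.exp ((∑ m ∈ Finset.range i, ‖β m‖) / 4 + 16 * b) := by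
        gcongr; linarith
      linarith [hexp i]
    refine tendsto_atTop_mono hlow ?_
    refine Tendsto.const_mul_atTop (by norm_num) (Real.tendsto_exp_atTop.comp ?_)
    refine Tendsto.atTop_div_const (by norm_num) ?_
    exact (not_summable_iff_tendsto_nat_atTop_of_nonneg fun i => norm_nonneg _).1 hsum

/-! ### Random phases -/

/-- There are independent rotationally symmetric random variables uniform on the circle of
radius `1 / 2`. -/
theorem exists_iIndepFun_uniform_circle :
    ∃ (Ω : Type) (_ : MeasurableSpace Ω) (P : Measure Ω) (_ : IsProbabilityMeasure P)
      (ω : ℕ → Ω → ℂ), (∀ n, Measurable (ω n)) ∧ (∀ n x, ‖ω n x‖ = 1 / 2) ∧ iIndepFun ω P ∧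
      ∀ n, IsRotationallySymmetric P (ω n) := by
  let h : UnitAddCircle → ℂ := fun t => (AddCircle.toCircle t : ℂ) / 2
  have hmeas : Measurable h :=
    ((continuous_subtype_val.comp AddCircle.continuous_toCircle).div_const _).measurable
  refine ⟨ℕ → UnitAddCircle, inferInstance,
    Measure.infinitePi fun _ => (AddCircle.haarAddCircle : Measure UnitAddCircle), inferInstance,
    fun n x => h (x n), fun n => by fun_prop,
    fun n x => by simp only [h, norm_div, Circle.norm_coe]; norm_num,
    iIndepFun_infinitePi fun _ => hmeas, fun n u hu => ?_⟩
  have hmeas_n : Measurable fun x : ℕ → UnitAddCircle => h (x n) :=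
    hmeas.comp (measurable_pi_apply n)
  have heval := measurePreserving_eval_infinitePi
    (fun _ : ℕ => (AddCircle.haarAddCircle : Measure UnitAddCircle)) n
  obtain ⟨t, ht⟩ := (AddCircle.homeomorphCircle (T := 1) one_ne_zero).surjective
    ⟨u, mem_sphere_zero_iff_norm.2 hu⟩
  have htu : (AddCircle.toCircle t : ℂ) = u := by
    rw [← AddCircle.homeomorphCircle_apply one_ne_zero, ht]
  have hrot := measurePreserving_add_left (AddCircle.haarAddCircle : Measure UnitAddCircle) t
  have hshift : (fun x : ℕ → UnitAddCircle => u * h (x n)) = fun x => h (t + x n) := by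
    funext x
    simp only [h, AddCircle.toCircle_add, Circle.coe_mul, htu]
    ring
  refine ⟨(hmeas_n.const_mul u).aemeasurable, hmeas_n.aemeasurable, ?_⟩
  rw [hshift]
  have h1 := (hrot.comp heval).map_eq
  have h2 := heval.map_eq
  have e1 := Measure.map_map hmeas (hrot.comp heval).measurable
    (μ := Measure.infinitePi fun _ : ℕ => (AddCircle.haarAddCircle : Measure UnitAddCircle))
  have e2 := Measure.map_map hmeas heval.measurable
    (μ := Measure.infinitePi fun _ : ℕ => (AddCircle.haarAddCircle : Measure UnitAddCircle))
  rw [h1] at e1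
  rw [h2] at e2
  exact e1.symm.trans e2

/-! ### A non-summable sequence with small square tails -/

theorem sum_range_inv_sqrt_le (n : ℕ) : ∑ i ∈ Finset.range n, 1 / √(i + 1 : ℝ) ≤ 2 * √n := by
  induction n with
  | zero => simp
  | succ n ih =>
    rw [Finset.sum_range_succ]
    have h1 : 0 < √(n + 1 : ℝ) := by positivity
    have h2 : √(n + 1 : ℝ) ^ 2 = n + 1 := Real.sq_sqrt (by positivity)
    have h3 : √(n : ℝ) ^ 2 = n := Real.sq_sqrt (by positivity)
    have h4 : 1 / √(n + 1 : ℝ) ≤ 2 * √(n + 1 : ℝ) - 2 * √n := by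
      rw [div_le_iff₀ h1]
      nlinarith [sq_nonneg (√(n + 1 : ℝ) - √n)]
    push_cast
    linarith

theorem le_sum_range_inv_sqrt (n : ℕ) : √n ≤ ∑ i ∈ Finset.range n, 1 / √(i + 1 : ℝ) := by
  have h : ∀ i ∈ Finset.range n, 1 / √(n : ℝ) ≤ 1 / √(i + 1 : ℝ) := by
    intro i hi
    have : i + 1 ≤ n := Finset.mem_range.1 hi
    have h' : (i + 1 : ℝ) ≤ n := by exact_mod_cast this
    gcongr
  have := Finset.sum_le_sum h
  rw [Finset.sum_const, Finset.card_range, nsmul_eq_mul, mul_one_div, Real.div_sqrt] at this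
  exact this

/-- A Cesàro argument: `1 / μ → 0`, and the weights `1 / √(i+1)` have partial sums of order `√n`. -/
theorem tendsto_weighted_mean_inv_sqrt {μ : ℕ → ℝ} (hμ : Tendsto μ atTop atTop) :
    Tendsto (fun n : ℕ => (∑ i ∈ Finset.range n, 1 / (μ i * √(i + 1 : ℝ))) / √n)
      atTop (nhds 0) := by
  have hsqrt : Tendsto (fun n : ℕ => √(n : ℝ)) atTop atTop :=
    Real.tendsto_sqrt_atTop.comp tendsto_natCast_atTop_atTop
  have h1 : (fun i : ℕ => 1 / (μ i * √(i + 1 : ℝ))) =o[atTop] fun i : ℕ => 1 / √(i + 1 : ℝ) := by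
    have h2 : (fun i : ℕ => (μ i)⁻¹) =o[atTop] fun _ : ℕ => (1 : ℝ) :=
      (Asymptotics.isLittleO_one_iff ℝ).2 hμ.inv_tendsto_atTop
    have h3 := h2.mul_isBigO (Asymptotics.isBigO_refl (fun i : ℕ => 1 / √(i + 1 : ℝ)) atTop)
    refine (h3.congr (fun i => ?_) fun i => ?_)
    · rw [one_div, one_div, mul_inv]
    · rw [one_mul]
  have h4 := h1.sum_range (fun i => by positivity)
    (tendsto_atTop_mono le_sum_range_inv_sqrt hsqrt)
  have h5 : (fun n : ℕ => ∑ i ∈ Finset.range n, 1 / √(i + 1 : ℝ)) =O[atTop] fun n : ℕ => √(n : ℝ) :=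
    Asymptotics.IsBigO.of_bound 2 (Eventually.of_forall fun n => by
      rw [Real.norm_of_nonneg (by positivity), Real.norm_of_nonneg (by positivity)]
      exact sum_range_inv_sqrt_le n)
  exact (h4.trans_isBigO h5).tendsto_div_nhds_zero

theorem Summable.tsum_sq_le_sq_tsum {y : ℕ → ℝ} (hy : ∀ k, 0 ≤ y k) (hs : Summable y) :
    Summable (fun k => y k ^ 2) ∧ ∑' k, y k ^ 2 ≤ (∑' k, y k) ^ 2 := by
  have h : ∀ k, y k ^ 2 ≤ y k * ∑' k, y k := fun k => by
    rw [sq]; exact mul_le_mul_of_nonneg_left (hs.le_tsum k fun j _ => hy j) (hy k)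
  have hs2 : Summable fun k => y k ^ 2 :=
    Summable.of_nonneg_of_le (fun k => sq_nonneg _) h (hs.mul_right _)
  refine ⟨hs2, (hs2.tsum_le_tsum h (hs.mul_right _)).trans (le_of_eq ?_)⟩
  rw [tsum_mul_right, sq]

/-- For every `μ → ∞` there is a non-summable sequence whose square tails are small in a sense
weighted by `1 / μ`. -/
theorem exists_not_summable_tail_summable {μ : ℕ → ℝ} (hμ1 : ∀ i, 1 ≤ μ i)
    (hμ : Tendsto μ atTop atTop) :
    ∃ c : ℕ → ℝ, (∀ i, 0 ≤ c i) ∧ (∀ i, c i < 1) ∧ ¬ Summable c ∧ Summable (fun i => c i ^ 2) ∧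
      Summable fun i : ℕ => √(∑' m, c (i + m) ^ 2) / (μ i * √(i + 1 : ℝ)) := by
  have hmean := tendsto_weighted_mean_inv_sqrt hμ
  have hex : ∀ k : ℕ, ∃ n : ℕ, 4 ^ (k + 2) ≤ n ∧
      (∑ i ∈ Finset.range n, 1 / (μ i * √(i + 1 : ℝ))) / √n ≤ (1 / 2) ^ k := fun k =>
    ((eventually_ge_atTop _).and
      (hmean.eventually_le_const (show (0 : ℝ) < (1 / 2) ^ k by positivity))).exists
  choose n hn4 hnA using hex
  have hnR : ∀ k, (4 : ℝ) ^ (k + 2) ≤ n k := fun k => by exact_mod_cast hn4 k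
  have hn0 : ∀ k, (0 : ℝ) < n k := fun k => lt_of_lt_of_le (by positivity) (hnR k)
  -- `y k i = 1_{i < n_k} / √n_k`
  let y : ℕ → ℕ → ℝ := fun k i => if i < n k then 1 / √(n k) else 0
  -- `e k` is the squared block `1_{i < n_k} / n_k`; `y k i` bounds the root of its tail from `i`.
  let e : ℕ → ℕ → ℝ := fun k i => if i < n k then 1 / (n k : ℝ) ^ 2 else 0
  have hy0 : ∀ k i, 0 ≤ y k i := fun k i => by simp only [y]; split_ifs <;> positivity
  have he0 : ∀ k i, 0 ≤ e k i := fun k i => by simp only [e]; split_ifs <;> positivity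
  have hyle : ∀ k i, y k i ≤ 1 / 4 * (1 / 2) ^ k := fun k i => by
    have h1 : 1 / √(n k) ≤ 1 / 4 * (1 / 2) ^ k := by
      have h2 : (2 : ℝ) ^ (k + 2) ≤ √(n k) := by
        apply Real.le_sqrt_of_sq_le
        rw [← pow_mul, mul_comm, pow_mul]; norm_num; exact hnR k
      calc _ ≤ 1 / (2 : ℝ) ^ (k + 2) := by gcongr
        _ = _ := by rw [pow_add, one_div_pow]; field_simp; norm_num
    simp only [y]; split_ifs
    · exact h1
    · positivity
  have hgeo : HasSum (fun k : ℕ => 1 / 4 * (1 / 2 : ℝ) ^ k) (1 / 4 * 2) :=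
    hasSum_geometric_two.mul_left _
  have hys : ∀ i, Summable fun k => y k i := fun i =>
    Summable.of_nonneg_of_le (fun k => hy0 k i) (fun k => hyle k i) hgeo.summable
  have hysum : ∀ i, ∑' k, y k i ≤ 1 / 2 := fun i => by
    have := (hys i).tsum_le_tsum (fun k => hyle k i) hgeo.summable
    rw [hgeo.tsum_eq] at this
    linarith
  have hysq : ∀ k i, y k i ^ 2 = if i < n k then 1 / (n k : ℝ) else 0 := fun k i => by
    simp only [y]; split_ifs
    · rw [div_pow, Real.sq_sqrt (hn0 k).le, one_pow]
    · simp
  have hn1 : ∀ k, (1 : ℝ) ≤ n k := fun k => (one_le_pow₀ (by norm_num)).trans (hnR k)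
  have hey : ∀ k i, e k i ≤ y k i ^ 2 := fun k i => by
    rw [hysq]; simp only [e]; split_ifs
    · exact one_div_le_one_div_of_le (hn0 k) (le_self_pow₀ (hn1 k) two_ne_zero)
    · rfl
  have hes : ∀ i, Summable fun k => e k i := fun i =>
    Summable.of_nonneg_of_le (fun k => he0 k i) (fun k => hey k i)
      (Summable.tsum_sq_le_sq_tsum (fun k => hy0 k i) (hys i)).1
  have he_nonneg : ∀ i, 0 ≤ ∑' k, e k i := fun i => tsum_nonneg fun k => he0 k i
  -- tails of each row
  have hrow : ∀ k i, Summable (fun m => e k (i + m)) ∧ ∑' m, e k (i + m) ≤ y k i ^ 2 := by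
    intro k i
    have hz : ∀ m ∉ Finset.range (n k - i), e k (i + m) = 0 := fun m hm => by
      simp only [Finset.mem_range, not_lt] at hm
      simp only [e]; rw [if_neg (by omega)]
    have hs : HasSum (fun m => e k (i + m)) _ := hasSum_sum_of_ne_finset_zero hz
    refine ⟨hs.summable, ?_⟩
    rw [hs.tsum_eq, hysq]
    by_cases hi : i < n k
    · rw [if_pos hi]
      calc _ ≤ ∑ m ∈ Finset.range (n k - i), 1 / (n k : ℝ) ^ 2 :=
            Finset.sum_le_sum fun m _ => by simp only [e]; split_ifs <;> first | rfl | positivity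
        _ = ((n k - i : ℕ) : ℝ) * (1 / (n k : ℝ) ^ 2) := by simp
        _ ≤ n k * (1 / (n k : ℝ) ^ 2) := by
            gcongr; exact Nat.sub_le _ _
        _ = _ := by have := (hn0 k).ne'; field_simp
    · rw [if_neg hi, show n k - i = 0 by omega]; simp
  let c : ℕ → ℝ := fun i => √(∑' k, e k i)
  have hcsq : ∀ i, c i ^ 2 = ∑' k, e k i := fun i => Real.sq_sqrt (he_nonneg i)
  have htail : ∀ i, Summable (fun m => c (i + m) ^ 2) ∧ √(∑' m, c (i + m) ^ 2) ≤ ∑' k, y k i := by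
    intro i
    obtain ⟨hs2, hle2⟩ := Summable.tsum_sq_le_sq_tsum (fun k => hy0 k i) (hys i)
    have hprod : Summable fun p : ℕ × ℕ => e p.1 (i + p.2) :=
      (summable_prod_of_nonneg fun p => he0 _ _).2 ⟨fun k => (hrow k i).1,
        Summable.of_nonneg_of_le (fun k => tsum_nonneg fun m => he0 _ _)
          (fun k => (hrow k i).2) hs2⟩
    have hcomm : ∑' m, ∑' k, e k (i + m) = ∑' k, ∑' m, e k (i + m) := Summable.tsum_comm hprod
    simp only [hcsq]
    refine ⟨hprod.prod_symm.prod, ?_⟩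
    rw [hcomm]
    apply Real.sqrt_le_iff.2
    refine ⟨tsum_nonneg fun k => hy0 k i, ?_⟩
    exact (hprod.prod.tsum_le_tsum (fun k => (hrow k i).2) hs2).trans hle2
  have hv0 : ∀ i : ℕ, 0 < μ i * √(i + 1 : ℝ) := fun i => by
    have := hμ1 i; positivity
  refine ⟨c, fun i => Real.sqrt_nonneg _, fun i => ?_, fun hc => ?_, by simpa using (htail 0).1, ?_⟩
  · have h1 : c i ^ 2 ≤ (1 / 2) ^ 2 := by
      rw [hcsq]
      obtain ⟨hs2, hle2⟩ := Summable.tsum_sq_le_sq_tsum (fun k => hy0 k i) (hys i)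
      have h2 : 0 ≤ ∑' k, y k i := tsum_nonneg fun k => hy0 k i
      exact (((hes i).tsum_le_tsum (fun k => hey k i) hs2).trans hle2).trans
        (pow_le_pow_left₀ h2 (hysum i) 2)
    have := abs_le_of_sq_le_sq h1 (by norm_num)
    linarith [le_abs_self (c i)]
  · have hlow : ∀ k i, i < n k → 1 / (n k : ℝ) ≤ c i := fun k i hi => by
      apply Real.le_sqrt_of_sq_le
      have := (hes i).le_tsum k fun j _ => he0 j i
      simp only [e, if_pos hi] at this
      rwa [div_pow, one_pow]
    -- Summability would make some tail less than `1/2`, but a block with `n_k ≥ 2 m` has at least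
    -- half its mass beyond `m`.
    obtain ⟨m, hm⟩ := ((tendsto_sum_nat_add c).eventually_lt_const
      (show (0 : ℝ) < 1 / 2 by norm_num)).exists
    obtain ⟨k, hk⟩ : ∃ k, 2 * m ≤ n k := by
      refine ⟨m, ?_⟩
      have h2 : m < 4 ^ m := Nat.lt_pow_self (by norm_num)
      have := hn4 m
      rw [pow_add] at this
      omega
    have hs := (summable_nat_add_iff m).2 hc
    have h1 := hs.sum_le_tsum (Finset.range (n k - m)) fun i _ => Real.sqrt_nonneg _
    have h2 : ∑ i ∈ Finset.range (n k - m), 1 / (n k : ℝ) ≤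
        ∑ i ∈ Finset.range (n k - m), c (i + m) := Finset.sum_le_sum fun i hi => by
      rw [Finset.mem_range] at hi
      exact hlow k _ (by omega)
    rw [Finset.sum_const, Finset.card_range, nsmul_eq_mul] at h2
    have h3 : (n k : ℝ) / 2 ≤ ((n k - m : ℕ) : ℝ) := by
      rw [Nat.cast_sub (by omega)]
      have : (2 * m : ℝ) ≤ n k := by exact_mod_cast hk
      linarith
    have h4 : (1 : ℝ) / 2 ≤ ((n k - m : ℕ) : ℝ) * (1 / (n k : ℝ)) := by
      rw [mul_one_div, le_div_iff₀ (hn0 k)]; linarith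
    linarith
  · have hprod : Summable fun p : ℕ × ℕ => y p.1 p.2 * (1 / (μ p.2 * √(p.2 + 1 : ℝ))) := by
      refine (summable_prod_of_nonneg fun p =>
        mul_nonneg (hy0 _ _) (one_div_nonneg.2 (hv0 _).le)).2 ?_
      have hk : ∀ k, HasSum (fun i : ℕ => y k i * (1 / (μ i * √(i + 1 : ℝ))))
          ((∑ i ∈ Finset.range (n k), 1 / (μ i * √(i + 1 : ℝ))) / √(n k)) := fun k => by
        have hz : ∀ i ∉ Finset.range (n k), y k i * (1 / (μ i * √(i + 1 : ℝ))) = 0 :=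
          fun i hi => by
            rw [Finset.mem_range] at hi
            simp only [y, if_neg hi, zero_mul]
        have hs : HasSum (fun i : ℕ => y k i * (1 / (μ i * √(i + 1 : ℝ)))) _ :=
          hasSum_sum_of_ne_finset_zero hz
        convert hs using 1
        rw [Finset.sum_div]
        refine Finset.sum_congr rfl fun i hi => ?_
        simp only [y, if_pos (Finset.mem_range.1 hi)]
        ring
      refine ⟨fun k => (hk k).summable, ?_⟩
      refine Summable.of_nonneg_of_le (fun k => tsum_nonneg fun i =>
        mul_nonneg (hy0 _ _) (one_div_nonneg.2 (hv0 _).le)) (fun k => ?_) summable_geometric_two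
      dsimp only
      rw [(hk k).tsum_eq]
      exact hnA k
    refine Summable.of_nonneg_of_le (fun i => div_nonneg (Real.sqrt_nonneg _) (hv0 i).le)
      (fun i => ?_) hprod.prod_symm.prod
    simp only [Prod.fst_swap, Prod.snd_swap]
    rw [tsum_mul_right, mul_one_div]
    have := (htail i).2
    have := (hv0 i).le
    gcongr

/-! ### From lacunary iterates to Verblunsky coefficients -/

/-- The indices `128 ^ (i + 1) - 1` of the nonzero Verblunsky coefficients. -/
def lacunaryIndex (i : ℕ) : ℕ := 128 ^ (i + 1) - 1

theorem lacunaryIndex_add_one (i : ℕ) : lacunaryIndex i + 1 = 128 ^ (i + 1) :=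
  Nat.sub_add_cancel (Nat.one_le_pow _ _ (by norm_num))

theorem lacunaryIndex_strictMono : StrictMono lacunaryIndex := by
  refine strictMono_nat_of_lt_succ fun i => ?_
  have h1 := lacunaryIndex_add_one i
  have h2 := lacunaryIndex_add_one (i + 1)
  have : 128 ^ (i + 1) < 128 ^ (i + 1 + 1) := Nat.pow_lt_pow_right (by norm_num) (by omega)
  omega

theorem norm_szegoPoly_eval (α : ℕ → ℂ) (n : ℕ) (θ : ℝ) :
    ‖(szegoPoly α n).eval (Complex.exp (Complex.I * θ))‖
      = ‖(szegoRev α n).eval (Complex.exp (Complex.I * θ))‖ := by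
  rw [szegoRev_eval α n _ (norm_exp_I_mul θ)]
  simp

theorem szegoRev_succ_eval (α : ℕ → ℂ) (n : ℕ) (θ : ℝ) :
    (szegoRev α (n + 1)).eval (Complex.exp (Complex.I * θ))
      = szegoStep (n + 1) (α n)
        (fun θ => (szegoRev α n).eval (Complex.exp (Complex.I * θ))) θ := by
  set z := Complex.exp (Complex.I * θ) with hz
  have hz1 : ‖z‖ = 1 := norm_exp_I_mul θ
  have h1 : z * conj z = 1 := by
    rw [Complex.mul_conj, Complex.normSq_eq_norm_sq, hz1]; simp
  have hr : (szegoRev α (n + 1)).eval z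
      = (szegoRev α n).eval z - α n * z * (szegoPoly α n).eval z := by
    simp [szegoPoly, szegoRev, szegoPair]
  have h2 : Complex.exp (Complex.I * (((n + 1 : ℝ) * θ : ℝ) : ℂ)) = z ^ (n + 1) := by
    rw [hz, ← Complex.exp_nat_mul]; push_cast; ring_nf
  have h3 : z ^ n * conj z ^ n = 1 := by rw [← mul_pow, h1, one_pow]
  simp only [szegoStep, h2, ← hz]
  rw [hr, szegoRev_eval α n z hz1]
  simp only [map_mul, map_pow, Complex.conj_conj]
  linear_combination (α n * z * (szegoPoly α n).eval z) * h3

theorem szegoRev_eq_of_forall_eq_zero {α : ℕ → ℂ} {m n : ℕ} (hmn : m ≤ n)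
    (h : ∀ j, m ≤ j → j < n → α j = 0) : szegoRev α n = szegoRev α m := by
  induction n, hmn using Nat.le_induction with
  | base => rfl
  | succ n hn ih =>
    rw [← ih fun j h1 h2 => h j h1 (by omega)]
    simp [szegoRev, szegoPair, h n hn (by omega)]

/-- A zero coefficient leaves `Φ^*` unchanged, and the step at index `n` has frequency `n + 1`,
hence the shift by one in `lacunaryIndex`. -/
theorem szegoRev_lacunaryIndex_eval {α β : ℕ → ℂ} (hβ : ∀ i, α (lacunaryIndex i) = β i)
    (h0 : ∀ j ∉ Set.range lacunaryIndex, α j = 0) (i : ℕ) (θ : ℝ) :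
    (szegoRev α (lacunaryIndex i)).eval (Complex.exp (Complex.I * θ)) = lacunarySzego β i θ := by
  induction i generalizing θ with
  | zero =>
    rw [szegoRev_eq_of_forall_eq_zero (Nat.zero_le _) fun j _ hj => h0 j ?_]
    · simp [szegoRev, szegoPair, lacunarySzego]
    · rintro ⟨i, rfl⟩
      exact absurd (lacunaryIndex_strictMono.lt_iff_lt.1 hj) (by omega)
  | succ i ih =>
    have hlt : lacunaryIndex i < lacunaryIndex (i + 1) := lacunaryIndex_strictMono (by omega)
    rw [szegoRev_eq_of_forall_eq_zero (m := lacunaryIndex i + 1) hlt fun j h1 h2 => h0 j ?_]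
    · rw [szegoRev_succ_eval, hβ]
      have hN : (lacunaryIndex i + 1 : ℝ) = 128 ^ (i + 1) := by
        exact_mod_cast lacunaryIndex_add_one i
      simp only [lacunarySzego, hN, szegoStep, ih]
    · rintro ⟨k, rfl⟩
      have h3 := lacunaryIndex_strictMono.lt_iff_lt.1 h2
      have h4 := lacunaryIndex_strictMono.lt_iff_lt.1
        (show lacunaryIndex i < lacunaryIndex k by omega)
      omega

theorem exists_iSup_szegoPoly_eq_top {α : ℕ → ℂ}
    (hα : ∀ i, ‖α (lacunaryIndex i)‖ ≤ 1 / 2) (h0 : ∀ j ∉ Set.range lacunaryIndex, α j = 0)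
    (hsum : ¬ Summable fun i => ‖α (lacunaryIndex i)‖) :
    ∃ θ ∈ Set.Ico (0 : ℝ) (2 * Real.pi),
      ⨆ n : ℕ, ‖(szegoPoly α n).eval (Complex.exp (Complex.I * θ))‖ₑ = ∞ := by
  obtain ⟨θ, hθ, hlim⟩ := exists_lacunarySzego_unbounded (fun i => α (lacunaryIndex i)) hα hsum
  refine ⟨θ, hθ, iSup_eq_top.2 fun b hb => ?_⟩
  obtain ⟨i, hi⟩ := (hlim.eventually_gt_atTop b.toReal).exists
  refine ⟨lacunaryIndex i, ?_⟩
  rw [← ofReal_norm, norm_szegoPoly_eval,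
    szegoRev_lacunaryIndex_eval (fun _ => rfl) h0]
  exact (ENNReal.lt_ofReal_iff_toReal_lt hb.ne).2 hi

/-! ### Condensation of the tail condition -/

theorem tailSq_antitone {a : ℕ → ℝ} (ha : Summable fun j => a j ^ 2) : Antitone (tailSq a) := by
  refine antitone_nat_of_succ_le fun n => ?_
  have hs : Summable fun m => a (n + m) ^ 2 := by
    simpa only [add_comm n] using (summable_nat_add_iff n).2 ha
  have := hs.sum_add_tsum_nat_add 1
  simp only [Finset.sum_range_one, add_zero] at this
  simp only [tailSq]
  have h2 : ∀ m, a (n + 1 + m) = a (n + (m + 1)) := fun m => by congr 1; omega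
  simp only [h2]
  linarith [sq_nonneg (a n)]

theorem tailSq_extend_le {c : ℕ → ℝ} (hc : Summable fun i => c i ^ 2) (k : ℕ) :
    tailSq (Function.extend lacunaryIndex c 0) (128 ^ k) ≤ ∑' m, c (k + m) ^ 2 := by
  set a := Function.extend lacunaryIndex c 0 with ha_def
  have hinj := lacunaryIndex_strictMono.injective
  have hsq : (fun j => a j ^ 2) = Function.extend lacunaryIndex (fun i => c i ^ 2) 0 := by
    funext j
    by_cases hj : ∃ i, lacunaryIndex i = j
    · obtain ⟨i, rfl⟩ := hj
      rw [ha_def, hinj.extend_apply, hinj.extend_apply]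
    · rw [ha_def, Function.extend_apply' _ _ _ hj, Function.extend_apply' _ _ _ hj]; simp
  have hsum : HasSum (fun j => a j ^ 2) (∑' i, c i ^ 2) := by
    rw [hsq]; exact (hasSum_extend_zero hinj).2 hc.hasSum
  have h1 := hsum.summable.sum_add_tsum_nat_add (128 ^ k)
  have h2 := hc.sum_add_tsum_nat_add k
  rw [hsum.tsum_eq] at h1
  have h3 : ∑ i ∈ Finset.range k, c i ^ 2 ≤ ∑ j ∈ Finset.range (128 ^ k), a j ^ 2 := by
    have h4 : ∑ i ∈ Finset.range k, c i ^ 2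
        = ∑ j ∈ (Finset.range k).map ⟨lacunaryIndex, hinj⟩, a j ^ 2 := by
      rw [Finset.sum_map]
      exact Finset.sum_congr rfl fun i _ => by
        rw [Function.Embedding.coeFn_mk, ha_def, hinj.extend_apply]
    rw [h4]
    refine Finset.sum_le_sum_of_subset_of_nonneg (fun j hj => ?_) fun _ _ _ => sq_nonneg _
    simp only [Finset.mem_map, Finset.mem_range, Function.Embedding.coeFn_mk] at hj ⊢
    obtain ⟨i, hi, rfl⟩ := hj
    have h5 := lacunaryIndex_add_one i
    have h6 : 128 ^ (i + 1) ≤ 128 ^ k := Nat.pow_le_pow_right (by norm_num) hi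
    omega
  simp only [tailSq, add_comm (128 ^ k), add_comm k]
  linarith

theorem summable_sqrt_tailSq_div {a ν : ℕ → ℝ} (ha : Summable fun j => a j ^ 2)
    (hν : Monotone ν) (hν' : Tendsto ν atTop atTop)
    (h : Summable fun k : ℕ =>
      √(tailSq a (128 ^ k)) / (max (ν (128 ^ k)) 1 * √(k + 1 : ℝ))) :
    Summable fun n : ℕ => √(tailSq a n) / (ν n * (n : ℝ) * √(Real.log n)) := by
  -- The truncations at 1 keep the denominator positive for `n ≥ 1`, so `f` is antitone there as
  -- condensation requires; they are inactive for large `n`.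
  set f : ℕ → ℝ := fun n =>
    √(tailSq a n) / (max (ν n) 1 * (n : ℝ) * √(max (Real.log n) 1)) with hf
  have hanti := tailSq_antitone ha
  have hf0 : ∀ n, 0 ≤ f n := fun n => by positivity
  have hfsum : Summable f := by
    refine (summable_schlomilch_iff_of_nonneg (C := 128) (u := fun k => 128 ^ k) hf0 ?_
      (fun n => by positivity) (pow_right_strictMono₀ (by norm_num)) (by norm_num) ?_).1 ?_
    · intro m n hm hmn
      have h1 := hanti hmn
      have h2 := hν hmn
      have hm' : (0 : ℝ) < m := by exact_mod_cast hm
      have hmn' : (m : ℝ) ≤ n := by exact_mod_cast hmn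
      simp only [hf]
      gcongr
    · intro n
      simp only [smul_eq_mul, Nat.mul_sub]
      rw [pow_succ 128 (n + 1), pow_succ 128 n]
      omega
    · refine Summable.of_nonneg_of_le (fun k => mul_nonneg ?_ (hf0 _)) (fun k => ?_)
        (h.mul_left 127)
      · push_cast
        have : (128 : ℝ) ^ k ≤ 128 ^ (k + 1) := pow_le_pow_right₀ (by norm_num) (by omega)
        linarith
      -- Since `log 128 ≥ 2`, `k log 128 ≥ k + 1` for `k ≥ 1`; the truncation covers `k = 0`.
      · have hlog : (k + 1 : ℝ) ≤ max (Real.log ((128 ^ k : ℕ) : ℝ)) 1 := by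
          rcases Nat.eq_zero_or_pos k with rfl | hk
          · simp
          · refine le_max_of_le_left ?_
            have h1 : (1 : ℝ) ≤ k := by exact_mod_cast hk
            have h2 : (2 : ℝ) ≤ Real.log 128 := by
              rw [show (128 : ℝ) = 2 ^ 7 by norm_num, Real.log_pow]
              have := Real.log_two_gt_d9
              push_cast; linarith
            push_cast
            rw [Real.log_pow]
            nlinarith
        have hpos : (0 : ℝ) < 128 ^ k := by positivity
        calc _ = 127 * (√(tailSq a (128 ^ k)) /
              (max (ν (128 ^ k)) 1 * √(max (Real.log ((128 ^ k : ℕ) : ℝ)) 1))) := by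
              simp only [hf]; push_cast; rw [pow_succ]
              have : max (ν (128 ^ k)) 1 ≠ 0 := by positivity
              have : √(max (Real.log ((128 : ℝ) ^ k)) 1) ≠ 0 := by positivity
              field_simp; ring
          _ ≤ _ := by gcongr
  refine Summable.of_norm_bounded_eventually_nat hfsum ?_
  filter_upwards [eventually_ge_atTop 3, hν'.eventually_ge_atTop 1] with n hn hνn
  have hn' : (3 : ℝ) ≤ n := by exact_mod_cast hn
  have hlog : 1 ≤ Real.log n := by
    rw [Real.le_log_iff_exp_le (by linarith)]
    linarith [Real.exp_one_lt_d9]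
  rw [Real.norm_of_nonneg (by positivity)]
  simp only [hf, max_eq_left hνn, max_eq_left hlog, le_refl]

/-! ### Assembly -/

theorem theorem2 (ν : ℕ → ℝ) (hν_mono : Monotone ν) (hν_tendsto : Tendsto ν atTop atTop) :
    ∃ (a : ℕ → ℝ) (Ω : Type) (_ : MeasurableSpace Ω) (P : Measure Ω) (_ : IsProbabilityMeasure P)
      (ω : ℕ → Ω → ℂ),
      (∀ j, a j ∈ Set.Ioo (-1 : ℝ) 1) ∧
      (∀ n, Measurable (ω n)) ∧
      (∀ n x, ω n x ∈ Metric.ball (0 : ℂ) 1) ∧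
      iIndepFun ω P ∧
      (∀ n, IsRotationallySymmetric P (ω n)) ∧
      (∀ᵐ x ∂P, ∃ θ ∈ Set.Ico (0 : ℝ) (2 * Real.pi),
        ⨆ n : ℕ, ‖(szegoPoly (fun j => (a j : ℂ) * ω j x) n).eval
          (Complex.exp (Complex.I * θ))‖ₑ = ∞) ∧
      Summable (fun j => a j ^ 2) ∧
      Summable (fun n : {n : ℕ // 2 ≤ n ∧ ν n ≠ 0} =>
        √(tailSq a n) / (ν n * (n : ℝ) * √(Real.log n))) := by
  set μ : ℕ → ℝ := fun k => max (ν (128 ^ k)) 1 with hμ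
  have hμlim : Tendsto μ atTop atTop :=
    tendsto_atTop_mono (fun k => le_max_left _ _)
      (hν_tendsto.comp (tendsto_pow_atTop_atTop_of_one_lt (by norm_num)))
  obtain ⟨c, hc0, hc1, hcsum, hcsq, htail⟩ :=
    exists_not_summable_tail_summable (fun k => le_max_right _ _) hμlim
  obtain ⟨Ω, mΩ, P, hP, ω, hmeas, hnorm, hind, hrot⟩ := exists_iIndepFun_uniform_circle
  have hinj := lacunaryIndex_strictMono.injective
  set a : ℕ → ℝ := Function.extend lacunaryIndex c 0 with ha
  have ha_index : ∀ i, a (lacunaryIndex i) = c i := fun i => hinj.extend_apply _ _ _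
  have ha_zero : ∀ j ∉ Set.range lacunaryIndex, a j = 0 := fun j hj =>
    Function.extend_apply' _ _ _ hj
  have hasq : Summable fun j => a j ^ 2 := by
    refine (hinj.summable_iff fun j hj => by simp [ha_zero j hj]).1 ?_
    simpa only [Function.comp_def, ha_index] using hcsq
  refine ⟨a, Ω, mΩ, P, hP, ω, fun j => ?_, hmeas, fun n x => ?_, hind, hrot,
    Eventually.of_forall fun x => ?_, hasq, ?_⟩
  · by_cases hj : j ∈ Set.range lacunaryIndex
    · obtain ⟨i, rfl⟩ := hj
      rw [ha_index]
      exact ⟨by linarith [hc0 i], hc1 i⟩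
    · rw [ha_zero j hj]; norm_num
  · rw [mem_ball_zero_iff, hnorm]; norm_num
  · have hα : ∀ i, ‖(a (lacunaryIndex i) : ℂ) * ω (lacunaryIndex i) x‖ = c i * (1 / 2) := fun i => by
      rw [norm_mul, hnorm, ha_index, Complex.norm_real, Real.norm_of_nonneg (hc0 i)]
    refine exists_iSup_szegoPoly_eq_top (fun i => ?_) (fun j hj => by simp [ha_zero j hj]) ?_
    · rw [hα]; linarith [hc1 i]
    · simp only [hα]
      rwa [summable_mul_right_iff (by norm_num)]
  · refine (summable_sqrt_tailSq_div hasq hν_mono hν_tendsto ?_).subtype _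
    refine Summable.of_nonneg_of_le (fun k => by positivity) (fun k => ?_) htail
    have := tailSq_extend_le hcsq k
    gcongr
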